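/- Let $N$ be an oriented smooth Riemannian three-manifold with metric $g$ (for instance $N=\hat M\setminus(K\cup\{P_0\})$, the complement of a compact set and a point in a compact manifold), let $\xi$ be a smooth unit Killing vector field on $N$ (its flow is then automatically geodesic), and let $\vartheta=g(\xi,\cdot)$. Let $j$ be the endomorphism of $\xi^\perp$ for which $(v,jv,\xi)$ is a positively oriented orthonormal basis for every unit vector $v\in\xi^\perp$. Let $E\to N$ be a smooth complex vector bundle of finite rank with a smooth connection $\nabla$, and let $\varphi$ be a smooth section of $\mathrm{End}(E)$ (the Higgs field) such that the monopole equation $F_\nabla=2\star\nabla\varphi$ holds. Put $\phi:=-2i\varphi$ and $\hat\nabla:=\nabla+\phi\otimes\vartheta$; both connections also denote the induced connections on $\mathrm{End}(E)$, so that $\hat\nabla_v\Phi=\nabla_v\Phi+\vartheta(v)[\phi,\Phi]$, and they are extended complex linearly to complex tangent vectors. Let $\Phi$ be a smooth section of $\mathrm{End}(E)$ that is a Higgs potential, i.e. $\hat\nabla_\xi\Phi=\varphi$. Let $\sigma$ be a smooth unit vector field on $N$ with values in $\xi^\perp$, and put $Z:=\sigma-i\,j\sigma$, $\bar Z:=\sigma+i\,j\sigma$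 and $\lambda:=\tfrac14 g([\sigma,\xi],j\sigma)$. Suppose that $$\nabla_{\bar Z}(\nabla_Z\Phi)+\nabla_\xi\varphi=0\qquad\text{and}\qquad \lambda\nabla_Z\Phi-[\nabla_Z\varphi,\Phi]=0 .$$ Then $\psi:=-2i\,\hat\nabla_Z\Phi$ is a smooth section of $\mathrm{End}(E)$ and solves the coupled system $$\hat\nabla_{\bar Z}\psi=-\hat\nabla_\xi\phi,\qquad \hat\nabla_\xi\psi=\hat\nabla_Z\phi .$$ -/

import Mathlib

open Bundle Manifold FiberBundle
open scoped ContDiff Manifold TensorProduct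

noncomputable section

section Algebra

variable {V : Type*} [NormedAddCommGroup V] [InnerProductSpace ℝ V]
  [Fact (Module.finrank ℝ V = 3)]

/-- The cross product `u × v` on an oriented three-dimensional Euclidean space: the vector with
`⟪u × v, w⟫ = vol (u, v, w)` for all `w`. -/
def crossProd (o : Orientation ℝ V (Fin 3)) (u v : V) : V :=
  haveI : FiniteDimensional ℝ V := FiniteDimensional.of_fact_finrank_eq_succ 2
  haveI : CompleteSpace V := FiniteDimensional.complete ℝ V
  (InnerProductSpace.toDual ℝ V).symm
    (LinearMap.toContinuousLinearMap (o.volumeForm.toMultilinearMap.toLinearMap ![u, v, 0] 2))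

theorem inner_crossProd (o : Orientation ℝ V (Fin 3)) (u v w : V) :
    inner ℝ (crossProd o u v) w = o.volumeForm ![u, v, w] := by
  have h : Function.update ![u, v, 0] 2 w = ![u, v, w] := by
    ext i; fin_cases i <;> simp [Function.update]
  simp [crossProd, h]

/-- The Hodge star of a one-form `α` with values in `W`, as a two-form:
`(⋆α)(u, v) = α (u × v)`. For a positively oriented orthonormal basis `e₁, e₂, e₃` this reads
`(⋆α)(e₁, e₂) = α e₃` and cyclically. -/
def hodgeStar {W : Type*} [AddCommGroup W] [Module ℝ W] (o : Orientation ℝ V (Fin 3))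
    (α : V →ₗ[ℝ] W) (u v : V) : W :=
  α (crossProd o u v)

end Algebra

section Connections

variable {E₀ : Type*} [NormedAddCommGroup E₀] [NormedSpace ℝ E₀]
  {H : Type*} [TopologicalSpace H] (I : ModelWithCorners ℝ E₀ H)
  {N : Type*} [TopologicalSpace N] [ChartedSpace H N]
  (F : Type*) [NormedAddCommGroup F] [NormedSpace ℂ F]
  (E : N → Type*) [TopologicalSpace (TotalSpace F E)]
  [∀ x, AddCommGroup (E x)] [∀ x, Module ℂ (E x)] [∀ x, TopologicalSpace (E x)]
  [∀ x, IsTopologicalAddGroup (E x)] [∀ x, ContinuousSMul ℝ (E x)]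
  [FiberBundle F E]

/-- A connection on a complex vector bundle: a covariant derivative that is complex linear. -/
structure ComplexConnection extends CovariantDerivative I F E where
  map_I_smul : ∀ (s : Π x, E x) (x : N) (v : TangentSpace I x),
    MDifferentiableAt I (I.prod 𝓘(ℝ, F)) (fun y ↦ TotalSpace.mk' F y (s y)) x →
    toFun (fun y ↦ Complex.I • s y) x v = Complex.I • toFun s x v

variable {I F E}

/-- An endomorphism field, regarded as a section of the bundle of real linear endomorphisms. -/
def realEnd (Φ : Π x, E x →L[ℂ] E x) :
    N → TotalSpace (F →L[ℝ] F) (fun x ↦ E x →L[ℝ] E x) :=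
  fun x ↦ TotalSpace.mk' (F →L[ℝ] F) x ((Φ x).restrictScalars ℝ)

variable [VectorBundle ℂ F E] [VectorBundle ℝ F E]

variable (I F) in
/-- Smooth sections of the bundle of complex linear endomorphisms of `E`. -/
def IsSmoothEnd (Φ : Π x, E x →L[ℂ] E x) : Prop :=
  ContMDiff I (I.prod 𝓘(ℝ, F →L[ℝ] F)) ∞ (realEnd (F := F) Φ)

theorem mdifferentiableAt_I_smul_extend [ContMDiffVectorBundle 1 F E I] {x : N} (e : E x) :
    MDifferentiableAt I (I.prod 𝓘(ℝ, F))
      (fun y ↦ TotalSpace.mk' F y (Complex.I • extend F e y)) x := by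
  refine (mdifferentiableAt_extend I F (Complex.I • e)).congr_of_eventuallyEq ?_
  have hx := FiberBundle.mem_baseSet_trivializationAt F E x
  have h1 := ((trivializationAt F E x).linear ℂ hx).map_smul Complex.I e
  filter_upwards [(trivializationAt F E x).open_baseSet.mem_nhds hx] with y hy
  have h2 := ((trivializationAt F E x).symmₗ ℂ y).map_smul Complex.I
    ((trivializationAt F E x) ⟨x, e⟩).2
  rw [Trivialization.symmₗ_apply _ hy, Trivialization.symmₗ_apply _ hy] at h2
  simp only [extend, h1, h2]

theorem tensorialAt_endDeriv (cov : ComplexConnection I F E) (Φ : Π x, E x →L[ℂ] E x) (x : N)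
    (v : TangentSpace I x)
    (hΦ : MDifferentiableAt I (I.prod 𝓘(ℝ, F →L[ℝ] F)) (realEnd (F := F) Φ) x) :
    TensorialAt I F (fun s : Π y, E y ↦
      cov.toFun (fun y ↦ Φ y (s y)) x v - Φ x (cov.toFun s x v)) x := by
  have key : ∀ {s : Π y, E y},
      MDifferentiableAt I (I.prod 𝓘(ℝ, F)) (fun y ↦ TotalSpace.mk' F y (s y)) x →
      MDifferentiableAt I (I.prod 𝓘(ℝ, F)) (fun y ↦ TotalSpace.mk' F y (Φ y (s y))) x :=
    fun hs ↦ hΦ.clm_bundle_apply hs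
  have hc := cov.isCovariantDerivativeOnUniv
  constructor
  · intro f s hf hs
    have e : (fun y ↦ Φ y ((f • s) y)) = f • fun y ↦ Φ y (s y) := by
      funext y; exact ((Φ y).restrictScalars ℝ).map_smul (f y) (s y)
    have e2 : ∀ (r : ℝ) (w : E x), Φ x (r • w) = r • Φ x w :=
      fun r w ↦ ((Φ x).restrictScalars ℝ).map_smul r w
    simp only [e, hc.leibniz hs hf, hc.leibniz (key hs) hf]
    simp [e2]
    module
  · intro s s' hs hs'
    have e : (fun y ↦ Φ y ((s + s') y)) = (fun y ↦ Φ y (s y)) + fun y ↦ Φ y (s' y) := by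
      funext y; simp
    simp only [e, hc.add hs hs', hc.add (key hs) (key hs')]
    simp
    abel

variable [∀ x, ContinuousSMul ℂ (E x)] [FiniteDimensional ℂ F] [ContMDiffVectorBundle 1 F E I]

open Classical in
/-- The induced connection on endomorphisms: for `Φ` differentiable at `x`, the tensor
`v ↦ ∇_v Φ` at `x`, given by `(∇_v Φ) (s x) = ∇_v (Φ s) - Φ (∇_v s)` for sections `s`.
(Its value is `0` where `Φ` is not differentiable.) -/
def endDeriv (cov : ComplexConnection I F E) (Φ : Π x, E x →L[ℂ] E x) (x : N) :
    TangentSpace I x →ₗ[ℝ] (E x →L[ℂ] E x) :=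
  if hΦ : MDifferentiableAt I (I.prod 𝓘(ℝ, F →L[ℝ] F)) (realEnd (F := F) Φ) x then
    { toFun := fun v ↦
        { toFun := TensorialAt.mkHom _ x (tensorialAt_endDeriv cov Φ x v hΦ)
          map_add' := map_add _
          map_smul' := by
            intro c e
            have hI : ∀ e : E x, TensorialAt.mkHom _ x (tensorialAt_endDeriv cov Φ x v hΦ)
                (Complex.I • e) = Complex.I •
                  TensorialAt.mkHom _ x (tensorialAt_endDeriv cov Φ x v hΦ) e := by
              intro e
              have hs := mdifferentiableAt_extend I F e
              have hs' := mdifferentiableAt_I_smul_extend (I := I) (F := F) e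
              have h1 : Complex.I • e = (fun y ↦ Complex.I • extend F e y) x := by simp
              rw [h1, TensorialAt.mkHom_apply (tensorialAt_endDeriv cov Φ x v hΦ) hs',
                TensorialAt.mkHom_apply_eq_extend]
              simp only [map_smul]
              have h2 := cov.map_I_smul (fun y ↦ Φ y (extend F e y)) x v (hΦ.clm_bundle_apply hs)
              rw [cov.map_I_smul _ x v hs, h2]
              simp [smul_sub]
            have hc : ∀ w : E x, c • w = c.re • w + c.im • (Complex.I • w) := by
              intro w
              conv_lhs => rw [← Complex.re_add_im c, add_smul, mul_smul]
              rfl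
            rw [hc e, map_add, map_smul, map_smul, hI, ← hc]
            rfl
          cont := (TensorialAt.mkHom _ x (tensorialAt_endDeriv cov Φ x v hΦ)).cont }
      map_add' := by
        intro v w
        ext e
        simp [TensorialAt.mkHom_apply_eq_extend]
        abel
      map_smul' := by
        intro r v
        ext e
        have e2 : ∀ (r : ℝ) (w : E x), Φ x (r • w) = r • Φ x w :=
          fun r w ↦ ((Φ x).restrictScalars ℝ).map_smul r w
        simp [TensorialAt.mkHom_apply_eq_extend, e2, smul_sub] }
  else 0

theorem endDeriv_apply (cov : ComplexConnection I F E) {Φ : Π x, E x →L[ℂ] E x} {x : N}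
    (hΦ : MDifferentiableAt I (I.prod 𝓘(ℝ, F →L[ℝ] F)) (realEnd (F := F) Φ) x)
    {s : Π x, E x}
    (hs : MDifferentiableAt I (I.prod 𝓘(ℝ, F)) (fun y ↦ TotalSpace.mk' F y (s y)) x)
    (v : TangentSpace I x) :
    endDeriv cov Φ x v (s x) = cov.toFun (fun y ↦ Φ y (s y)) x v - Φ x (cov.toFun s x v) := by
  rw [endDeriv, dif_pos hΦ]
  exact TensorialAt.mkHom_apply (tensorialAt_endDeriv cov Φ x v hΦ) hs

/-- The induced connection on endomorphisms, extended complex linearly to complex tangent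
vectors: `∇_{u + i w} Φ = ∇_u Φ + i ∇_w Φ`. -/
def endDerivC (cov : ComplexConnection I F E) (Φ : Π x, E x →L[ℂ] E x) (x : N) :
    ℂ ⊗[ℝ] TangentSpace I x →ₗ[ℂ] (E x →L[ℂ] E x) :=
  (endDeriv cov Φ x).liftBaseChange ℂ

variable (I) in
/-- The curvature `F(X, Y) s = ∇_X ∇_Y s - ∇_Y ∇_X s - ∇_{[X, Y]} s`. -/
def curvature (cov : ComplexConnection I F E) (X Y : Π x : N, TangentSpace I x) (s : Π x, E x)
    (x : N) : E x :=
  cov.toFun (fun y ↦ cov.toFun s y (Y y)) x (X x) - cov.toFun (fun y ↦ cov.toFun s y (X y)) x (Y x)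
    - cov.toFun s x (VectorField.mlieBracket I X Y x)

/-- The connection `∇ + a ⊗ θ` on `E`, for an endomorphism field `a` and a one-form `θ`:
`s ↦ ∇ s + θ ⊗ a s`. -/
def addEndForm (cov : ComplexConnection I F E) (a : Π x, E x →L[ℂ] E x)
    (θ : Π x : N, TangentSpace I x →L[ℝ] ℝ) : ComplexConnection I F E where
  toFun s x := cov.toFun s x + (θ x).smulRight (a x (s x))
  isCovariantDerivativeOnUniv :=
    { add := by
        intro s s' x hs hs' _
        ext v
        simp [cov.isCovariantDerivativeOnUniv.add hs hs']
        abel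
      leibniz := by
        intro s g x hs hg _
        have e2 : ∀ (r : ℝ) (w : E x), a x (r • w) = r • a x w :=
          fun r w ↦ ((a x).restrictScalars ℝ).map_smul r w
        ext v
        simp [cov.isCovariantDerivativeOnUniv.leibniz hs hg, e2]
        module }
  map_I_smul := by
    intro s x v hs
    have h := cov.map_I_smul s x v hs
    have h2 : (θ x v) • (Complex.I • a x (s x)) = Complex.I • ((θ x v) • a x (s x)) :=
      smul_comm _ _ _
    simp only [add_apply, ContinuousLinearMap.smulRight_apply, map_smul, h, h2,
      smul_add]

end Connections

section ThreeManifolds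

variable {N : Type*} [TopologicalSpace N] [ChartedSpace (EuclideanSpace ℝ (Fin 3)) N]

instance fact_finrank_tangentSpace (x : N) :
    Fact (Module.finrank ℝ (TangentSpace (𝓡 3) x) = 3) :=
  ⟨finrank_euclideanSpace_fin (𝕜 := ℝ) (n := 3)⟩

/-- Smooth real vector fields. -/
def IsSmoothVF [IsManifold (𝓡 3) ∞ N] (X : Π x : N, TangentSpace (𝓡 3) x) : Prop :=
  ContMDiff (𝓡 3) ((𝓡 3).prod 𝓘(ℝ, EuclideanSpace ℝ (Fin 3))) ∞
    (fun x ↦ TotalSpace.mk' (EuclideanSpace ℝ (Fin 3)) x (X x))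

variable [IsManifold (𝓡 3) ∞ N] [RiemannianBundle (fun x : N ↦ TangentSpace (𝓡 3) x)]

/-- A choice of orientations of the tangent spaces is an orientation of the Riemannian manifold
if it varies smoothly, that is, if the resulting Riemannian volume form is smooth. -/
def IsSmoothOrientation (o : Π x : N, Orientation ℝ (TangentSpace (𝓡 3) x) (Fin 3)) : Prop :=
  ∀ X Y W : Π x : N, TangentSpace (𝓡 3) x, IsSmoothVF X → IsSmoothVF Y → IsSmoothVF W →
    ContMDiff (𝓡 3) 𝓘(ℝ, ℝ) ∞ (fun x ↦ (o x).volumeForm ![X x, Y x, W x])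

/-- `ξ` is a Killing field: the Lie derivative `𝓛_ξ g` of the metric vanishes. -/
def IsKilling (ξ : Π x : N, TangentSpace (𝓡 3) x) : Prop :=
  ∀ X Y : Π x : N, TangentSpace (𝓡 3) x, IsSmoothVF X → IsSmoothVF Y → ∀ x : N,
    mvfderiv (𝓡 3) (fun y ↦ inner ℝ (X y) (Y y)) x (ξ x)
      = inner ℝ (VectorField.mlieBracket (𝓡 3) ξ X x) (Y x)
        + inner ℝ (X x) (VectorField.mlieBracket (𝓡 3) ξ Y x)

/-- The rotation `j` of the plane `ξ^⊥`: for a unit vector `v ∈ ξ^⊥` (`ξ` being of unit length),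
`j v = ξ × v` is the vector for which `(v, j v, ξ)` is a positively oriented orthonormal basis. -/
def rot (o : Π x : N, Orientation ℝ (TangentSpace (𝓡 3) x) (Fin 3))
    (ξ v : Π x : N, TangentSpace (𝓡 3) x) (x : N) : TangentSpace (𝓡 3) x :=
  crossProd (o x) (ξ x) (v x)

/-- The complex vector field `Z = σ - i j σ`. -/
def fieldZ (o : Π x : N, Orientation ℝ (TangentSpace (𝓡 3) x) (Fin 3))
    (ξ σ : Π x : N, TangentSpace (𝓡 3) x) (x : N) : ℂ ⊗[ℝ] TangentSpace (𝓡 3) x :=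
  (1 : ℂ) ⊗ₜ[ℝ] σ x - Complex.I ⊗ₜ[ℝ] rot o ξ σ x

/-- The conjugate field `σ + i j σ`. -/
def fieldZbar (o : Π x : N, Orientation ℝ (TangentSpace (𝓡 3) x) (Fin 3))
    (ξ σ : Π x : N, TangentSpace (𝓡 3) x) (x : N) : ℂ ⊗[ℝ] TangentSpace (𝓡 3) x :=
  (1 : ℂ) ⊗ₜ[ℝ] σ x + Complex.I ⊗ₜ[ℝ] rot o ξ σ x

/-- The function `λ = (1/4) g([σ, ξ], j σ)`. -/
def lam (o : Π x : N, Orientation ℝ (TangentSpace (𝓡 3) x) (Fin 3))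
    (ξ σ : Π x : N, TangentSpace (𝓡 3) x) (x : N) : ℝ :=
  1 / 4 * inner ℝ (VectorField.mlieBracket (𝓡 3) σ ξ x) (rot o ξ σ x)

variable {F : Type*} [NormedAddCommGroup F] [NormedSpace ℂ F] [FiniteDimensional ℂ F]
  {E : N → Type*} [TopologicalSpace (TotalSpace F E)]
  [∀ x, AddCommGroup (E x)] [∀ x, Module ℂ (E x)] [∀ x, TopologicalSpace (E x)]
  [∀ x, IsTopologicalAddGroup (E x)] [∀ x, ContinuousSMul ℂ (E x)]
  [∀ x, ContinuousSMul ℝ (E x)]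
  [FiberBundle F E] [VectorBundle ℂ F E] [VectorBundle ℝ F E]
  [ContMDiffVectorBundle ∞ F E (𝓡 3)]

/-- The monopole equation `F_∇ = 2 ⋆ ∇φ`. -/
def IsMonopole (o : Π x : N, Orientation ℝ (TangentSpace (𝓡 3) x) (Fin 3))
    (cov : ComplexConnection (𝓡 3) F E) (φ : Π x, E x →L[ℂ] E x) : Prop :=
  ∀ (X Y : Π x : N, TangentSpace (𝓡 3) x) (s : Π x, E x), IsSmoothVF X → IsSmoothVF Y →
    ContMDiff (𝓡 3) ((𝓡 3).prod 𝓘(ℝ, F)) ∞ (fun x ↦ TotalSpace.mk' F x (s x)) →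
    ∀ x, curvature (𝓡 3) cov X Y s x
      = ((2 : ℂ) • hodgeStar (o x) (endDeriv cov φ x) (X x) (Y x)) (s x)

/-- The endomorphism field `ϕ = -2 i φ`. -/
def twist (φ : Π x, E x →L[ℂ] E x) (x : N) : E x →L[ℂ] E x :=
  (-2 * Complex.I) • φ x

/-- The connection `∇̂ = ∇ + ϕ ⊗ ϑ`, where `ϕ = -2 i φ` and `ϑ = g(ξ, ·)`. -/
def hatConn (cov : ComplexConnection (𝓡 3) F E) (φ : Π x, E x →L[ℂ] E x)
    (ξ : Π x : N, TangentSpace (𝓡 3) x) : ComplexConnection (𝓡 3) F E :=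
  addEndForm cov (twist φ) (fun x ↦ innerSL ℝ (ξ x))

end ThreeManifolds

end

set_option linter.unusedSectionVars false

/-! ### Cross products in oriented Euclidean three-space -/

section CrossProduct

variable {V : Type*} [NormedAddCommGroup V] [InnerProductSpace ℝ V]
  [Fact (Module.finrank ℝ V = 3)] (o : Orientation ℝ V (Fin 3))

/-! Both σ and jσ are orthogonal to ξ, so ∇̂ and ∇ agree along Z and Z̄ and ψ = -2i ∇_Z Φ. Along ξ
they differ by [ϕ, ·]. Since [ϕ, ϕ] = 0, the first equation of the system is the first hypothesis on
Φ multiplied by -2i.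

The second equation needs ∇_ξ and ∇_Z interchanged (`IsMonopole.endDeriv_endDerivC_fieldZ`), and two
eigenvector relations make this work. Algebraically, ξ × Z = iZ, so the monopole equation turns the
curvature term into 2i[∇_Z φ, Φ]. Geometrically, ξ is a unit Killing field, so its flow preserves
ξ^⊥ and lengths; hence [ξ, σ] = k jσ and [ξ, jσ] = -k σ with k = -4λ, that is, [ξ, Z] = -4iλ Z.
Therefore ∇_ξ∇_Z Φ = ∇_Z∇_ξ Φ + 2i[∇_Z φ, Φ] - 4iλ ∇_Z Φ.

The potential equation says ∇_ξ Φ = φ - [ϕ, Φ]. Differentiating it along Z gives a second 2i[∇_Z φ,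
Φ] and the term -[ϕ, ∇_Z Φ], so ∇̂_ξ∇_Z Φ = ∇_Z φ - 4i(λ∇_Z Φ - [∇_Z φ, Φ]). The bracket vanishes by
the second hypothesis, and multiplying by -2i finishes.

The rest is calculus on sections: endomorphism fields are tested, for equality and for smoothness,
on global smooth sections, which exist through every vector by bump functions. -/

theorem inner_crossProd_left (u v : V) : inner ℝ (crossProd o u v) u = 0 := by
  rw [inner_crossProd]
  exact o.volumeForm.map_eq_zero_of_eq _ (i := 0) (j := 2) rfl (by decide)

theorem inner_crossProd_right (u v : V) : inner ℝ (crossProd o u v) v = 0 := by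
  rw [inner_crossProd]
  exact o.volumeForm.map_eq_zero_of_eq _ (i := 1) (j := 2) rfl (by decide)

theorem abs_volumeForm_of_orthogonal {u v w : V} (huv : inner ℝ u v = 0) (huw : inner ℝ u w = 0)
    (hvw : inner ℝ v w = 0) : |o.volumeForm ![u, v, w]| = ‖u‖ * ‖v‖ * ‖w‖ := by
  rw [o.abs_volumeForm_apply_of_pairwise_orthogonal, Fin.prod_univ_three]
  · rfl
  · intro i j hij
    fin_cases i <;> fin_cases j <;>
      simp_all [real_inner_comm]

/-- Supplies the test vector that shows a cross product of orthonormal vectors is not zero. -/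
theorem exists_orthogonal_pair (u v : V) :
    ∃ w : V, w ≠ 0 ∧ inner ℝ u w = 0 ∧ inner ℝ v w = 0 := by
  have : FiniteDimensional ℝ V := FiniteDimensional.of_fact_finrank_eq_succ 2
  have hlt : Submodule.span ℝ (Set.range ![u, v]) ≠ ⊤ := by
    intro h
    have h1 := finrank_range_le_card (R := ℝ) ![u, v]
    rw [Set.finrank, h, finrank_top, (Fact.out : Module.finrank ℝ V = 3)] at h1
    simp at h1
  have hne : (Submodule.span ℝ (Set.range ![u, v]))ᗮ ≠ ⊥ := by
    rwa [Ne, Submodule.orthogonal_eq_bot_iff]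
  obtain ⟨w, hw, hw0⟩ := Submodule.exists_mem_ne_zero_of_ne_bot hne
  rw [Submodule.mem_orthogonal] at hw
  exact ⟨w, hw0, hw u (Submodule.subset_span (by simp)), hw v (Submodule.subset_span (by simp))⟩

/-- With c = u × v, the number vol(u, v, c) is ‖c‖² by definition of c, and ‖c‖ in absolute value
because u, v, c are orthogonal. So ‖c‖ is 0 or 1, and 0 is impossible since the volume form does not
vanish on nonzero orthogonal triples. -/
theorem norm_crossProd_of_orthonormal {u v : V} (hu : ‖u‖ = 1) (hv : ‖v‖ = 1)
    (huv : inner ℝ u v = 0) : ‖crossProd o u v‖ = 1 := by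
  set c := crossProd o u v with hc
  have hcu : inner ℝ u c = 0 := by rw [real_inner_comm]; exact inner_crossProd_left o u v
  have hcv : inner ℝ v c = 0 := by rw [real_inner_comm]; exact inner_crossProd_right o u v
  have h1 := abs_volumeForm_of_orthogonal o huv hcu hcv
  rw [← inner_crossProd, ← hc, real_inner_self_eq_norm_sq, hu, hv, abs_of_nonneg (sq_nonneg _)] at h1
  have h0 : ‖c‖ ≠ 0 := by
    intro h0
    obtain ⟨w, hw, huw, hvw⟩ := exists_orthogonal_pair u v
    have h2 := abs_volumeForm_of_orthogonal o huv huw hvw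
    rw [← inner_crossProd, ← hc, norm_eq_zero.mp h0] at h2
    simp [hu, hv, hw, eq_comm] at h2
  have : ‖c‖ * (‖c‖ - 1) = 0 := by linear_combination h1
  rcases mul_eq_zero.mp this with h | h
  · exact absurd h h0
  · linarith

/-- A vector of a three-dimensional Euclidean space is determined by its inner products with two
orthonormal vectors and their cross product. -/
theorem ext_inner_frame {u v : V} (hu : ‖u‖ = 1) (hv : ‖v‖ = 1) (huv : inner ℝ u v = 0) {x y : V}
    (h₁ : inner ℝ x u = inner ℝ y u) (h₂ : inner ℝ x v = inner ℝ y v)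
    (h₃ : inner ℝ x (crossProd o u v) = inner ℝ y (crossProd o u v)) : x = y := by
  have : FiniteDimensional ℝ V := FiniteDimensional.of_fact_finrank_eq_succ 2
  have hc := norm_crossProd_of_orthonormal o hu hv huv
  have hcu := inner_crossProd_left o u v
  have hcv := inner_crossProd_right o u v
  have hon : Orthonormal ℝ ![u, v, crossProd o u v] := by
    refine ⟨fun i ↦ by fin_cases i <;> simp [hu, hv, hc], fun i j hij ↦ ?_⟩
    fin_cases i <;> fin_cases j <;> simp_all [real_inner_comm]
  let b := basisOfOrthonormalOfCardEqFinrank hon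
    (by simp [(Fact.out : Module.finrank ℝ V = 3)])
  have h : innerₗ V x = innerₗ V y := by
    refine b.ext fun i ↦ ?_
    simp only [b, coe_basisOfOrthonormalOfCardEqFinrank]
    fin_cases i <;> simpa
  exact ext_inner_right ℝ fun w ↦ LinearMap.congr_fun h w

/-- This is j² = -1 on ξ^⊥. The only component that is not zero on both sides is the one along v,
where antisymmetry of the volume form reduces it to ‖u × v‖ = 1. -/
theorem crossProd_crossProd_self {u v : V} (hu : ‖u‖ = 1) (hv : ‖v‖ = 1) (huv : inner ℝ u v = 0) :
    crossProd o u (crossProd o u v) = -v := by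
  refine ext_inner_frame o hu hv huv ?_ ?_ ?_
  · rw [inner_crossProd_left, inner_neg_left, real_inner_comm, huv, neg_zero]
  · rw [inner_crossProd, inner_neg_left, real_inner_self_eq_norm_sq, hv]
    have h := o.volumeForm.map_swap ![u, v, crossProd o u v] (i := 1) (j := 2) (by decide)
    have e : ![u, v, crossProd o u v] ∘ Equiv.swap (1 : Fin 3) 2 = ![u, crossProd o u v, v] := by
      funext i; fin_cases i <;> rfl
    rw [e, ← inner_crossProd o u v, real_inner_self_eq_norm_sq,
      norm_crossProd_of_orthonormal o hu hv huv] at h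
    exact h
  · rw [inner_crossProd_right, inner_neg_left, real_inner_comm, inner_crossProd_right, neg_zero]

end CrossProduct

/-! ### Global smooth sections as test objects -/

section Sections

variable {E₀ : Type*} [NormedAddCommGroup E₀] [NormedSpace ℝ E₀] [FiniteDimensional ℝ E₀]
  {H : Type*} [TopologicalSpace H] {I : ModelWithCorners ℝ E₀ H}
  {N : Type*} [TopologicalSpace N] [ChartedSpace H N] [IsManifold I ∞ N] [T2Space N]
  {F : Type*} [NormedAddCommGroup F] [NormedSpace ℝ F]
  {E : N → Type*} [TopologicalSpace (TotalSpace F E)]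
  [∀ x, AddCommGroup (E x)] [∀ x, Module ℝ (E x)] [∀ x, TopologicalSpace (E x)]
  [FiberBundle F E] [VectorBundle ℝ F E] [ContMDiffVectorBundle ∞ F E I]

variable (I F) in
/-- Every vector in a fibre extends to a global smooth section, which may be taken constant near
the base point in a given trivialization. -/
theorem exists_contMDiff_section_eventuallyEq {x₀ : N} (e : E x₀) :
    ∃ s : Π x, E x, ContMDiff I (I.prod 𝓘(ℝ, F)) ∞ (fun x ↦ TotalSpace.mk' F x (s x)) ∧
      ∀ᶠ x in nhds x₀, s x = extend F e x := by
  set t := trivializationAt F E x₀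
  have hx₀ : t.baseSet ∈ nhds x₀ := t.open_baseSet.mem_nhds (mem_baseSet_trivializationAt' x₀)
  -- `extend` is controlled only over the base set of the trivialization, so it is cut off by a bump
  -- function supported there and equal to 1 near x₀.
  obtain ⟨f, hf, -⟩ := (SmoothBumpFunction.nhds_basis_support (I := I) hx₀).mem_iff.mp hx₀
  refine ⟨fun x ↦ f x • extend F e x, ?_, ?_⟩
  · have hon : ContMDiffOn I (I.prod 𝓘(ℝ, F)) ∞
        (fun x ↦ TotalSpace.mk' F x (extend F e x)) t.baseSet := by
      intro x hx
      rw [t.contMDiffWithinAt_section _ hx]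
      exact (contMDiffWithinAt_const (c := (t ⟨x₀, e⟩).2)).congr
        (fun x hx ↦ by simp [extend, t, hx]) (by simp [extend, t, hx])
    have h := ContMDiffOn.smul_section_of_tsupport (s := extend F e) (ψ := f)
      (f.contMDiff.contMDiffOn (s := t.baseSet)) t.open_baseSet hf hon
    exact h
  · filter_upwards [f.eventuallyEq_one] with x hx
    simp [hx]

variable (I F) in
theorem exists_contMDiff_section_eq {x₀ : N} (e : E x₀) :
    ∃ s : Π x, E x, ContMDiff I (I.prod 𝓘(ℝ, F)) ∞ (fun x ↦ TotalSpace.mk' F x (s x)) ∧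
      s x₀ = e := by
  obtain ⟨s, hs, h⟩ := exists_contMDiff_section_eventuallyEq I F e
  exact ⟨s, hs, by simpa using h.self_of_nhds⟩

variable [FiniteDimensional ℝ F] [∀ x, IsTopologicalAddGroup (E x)] [∀ x, ContinuousSMul ℝ (E x)]

/-- A field of endomorphisms is smooth if it maps smooth sections to smooth sections. -/
theorem contMDiff_end_of_forall_section {Φ : Π x, E x →L[ℝ] E x}
    (h : ∀ s : Π x, E x, ContMDiff I (I.prod 𝓘(ℝ, F)) ∞ (fun x ↦ TotalSpace.mk' F x (s x)) →
      ContMDiff I (I.prod 𝓘(ℝ, F)) ∞ (fun x ↦ TotalSpace.mk' F x (Φ x (s x)))) :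
    ContMDiff I (I.prod 𝓘(ℝ, F →L[ℝ] F)) ∞ (fun x ↦ TotalSpace.mk' (F →L[ℝ] F) x (Φ x)) := by
  intro x₀
  rw [contMDiffAt_hom_bundle]
  refine ⟨contMDiffAt_id, ?_⟩
  let b := Module.finBasis ℝ F
  let t := trivializationAt F E x₀
  have hx₀ : x₀ ∈ t.baseSet := mem_baseSet_trivializationAt' x₀
  -- One column of the coordinate matrix of Φ: near x₀ it is the local representative of Φ applied
  -- to a section that is constant, equal to f, in the trivialization.
  have hev : ∀ f : F, ContMDiffAt I 𝓘(ℝ, F) ∞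
      (fun x ↦ ContinuousLinearMap.inCoordinates F E F E x₀ x x₀ x (Φ x) f) x₀ := by
    intro f
    obtain ⟨s, hs, hse⟩ := exists_contMDiff_section_eventuallyEq I F (t.symm x₀ f)
    have h1 := (contMDiffAt_section _).mp (h s hs x₀)
    refine h1.congr_of_eventuallyEq ?_
    filter_upwards [hse, t.open_baseSet.mem_nhds hx₀] with x hx hxt
    rw [ContinuousLinearMap.inCoordinates_eq hxt hxt]
    have e : extend F (t.symm x₀ f) x = t.symm x f := by
      have : (t ⟨x₀, t.symm x₀ f⟩).2 = f := by simp [t.apply_mk_symm hx₀]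
      simp only [extend]
      rw [this]
    simp only [ContinuousLinearMap.comp_apply, hx, e]
    rfl
  -- Rebuilds an endomorphism of F from its values on a basis; being linear in finite dimension,
  -- this is smooth, so smooth columns suffice.
  let L : (Fin (Module.finrank ℝ F) → F) →L[ℝ] (F →L[ℝ] F) :=
    LinearMap.toContinuousLinearMap
      (LinearMap.toContinuousLinearMap.toLinearMap ∘ₗ (b.constr ℝ).toLinearMap)
  have hL : ∀ A : F →L[ℝ] F, A = L (fun i ↦ A (b i)) := by
    intro A
    apply ContinuousLinearMap.coe_injective
    apply b.ext
    intro i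
    simp [L, b.constr_basis]
  have h2 : ContMDiffAt I 𝓘(ℝ, Fin (Module.finrank ℝ F) → F) ∞ (fun x i ↦
      ContinuousLinearMap.inCoordinates F E F E x₀ x x₀ x (Φ x) (b i)) x₀ :=
    contMDiffAt_pi_space.mpr fun i ↦ hev (b i)
  have h3 := L.contMDiff.contMDiffAt.comp x₀ h2
  refine h3.congr_of_eventuallyEq (Filter.Eventually.of_forall fun x ↦ ?_)
  exact hL _

end Sections

/-- Smooth global sections of a vector bundle. -/
def IsSmoothSection {E₀ : Type*} [NormedAddCommGroup E₀] [NormedSpace ℝ E₀]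
    {H : Type*} [TopologicalSpace H] (I : ModelWithCorners ℝ E₀ H)
    {N : Type*} [TopologicalSpace N] [ChartedSpace H N]
    (F : Type*) [NormedAddCommGroup F] [NormedSpace ℝ F]
    {E : N → Type*} [TopologicalSpace (TotalSpace F E)] [∀ x, TopologicalSpace (E x)]
    [FiberBundle F E] (s : Π x, E x) : Prop :=
  ContMDiff I (I.prod 𝓘(ℝ, F)) ∞ (fun x ↦ TotalSpace.mk' F x (s x))

/-! ### Calculus of the induced connection on endomorphism fields -/

section EndomorphismFields

variable {E₀ : Type*} [NormedAddCommGroup E₀] [NormedSpace ℝ E₀] [FiniteDimensional ℝ E₀]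
  {H : Type*} [TopologicalSpace H] {I : ModelWithCorners ℝ E₀ H}
  {N : Type*} [TopologicalSpace N] [ChartedSpace H N] [IsManifold I ∞ N] [T2Space N]
  {F : Type*} [NormedAddCommGroup F] [NormedSpace ℂ F] [FiniteDimensional ℂ F]
  {E : N → Type*} [TopologicalSpace (TotalSpace F E)]
  [∀ x, AddCommGroup (E x)] [∀ x, Module ℂ (E x)] [∀ x, TopologicalSpace (E x)]
  [∀ x, IsTopologicalAddGroup (E x)] [∀ x, ContinuousSMul ℂ (E x)]
  [∀ x, ContinuousSMul ℝ (E x)]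
  [FiberBundle F E] [VectorBundle ℂ F E] [VectorBundle ℝ F E]
  [ContMDiffVectorBundle ∞ F E I]

theorem IsSmoothSection.mdifferentiableAt {s : Π x, E x} (hs : IsSmoothSection I F s) (x : N) :
    MDifferentiableAt I (I.prod 𝓘(ℝ, F)) (fun y ↦ TotalSpace.mk' F y (s y)) x :=
  ContMDiff.mdifferentiableAt hs (by simp)

theorem IsSmoothEnd.mdifferentiableAt {Φ : Π x, E x →L[ℂ] E x} (hΦ : IsSmoothEnd I F Φ) (x : N) :
    MDifferentiableAt I (I.prod 𝓘(ℝ, F →L[ℝ] F)) (realEnd (F := F) Φ) x :=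
  ContMDiff.mdifferentiableAt hΦ (by simp)

theorem IsSmoothSection.sub {s t : Π x, E x} (hs : IsSmoothSection I F s)
    (ht : IsSmoothSection I F t) : IsSmoothSection I F (fun x ↦ s x - t x) :=
  ContMDiff.sub_section hs ht

theorem IsSmoothSection.const_smul {s : Π x, E x} (hs : IsSmoothSection I F s) (c : ℂ) :
    IsSmoothSection I F (fun x ↦ c • s x) := by
  intro x₀
  refine (contMDiffAt_section _).mpr ?_
  set t := trivializationAt F E x₀
  have h1 := (contMDiffAt_section _).mp (hs x₀)
  -- Smoothness is over ℝ, so multiplication by the complex number c is used as a real linear map of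
  -- F; complex linearity of the trivialization carries it to the fibres.
  have h2 := (((c • ContinuousLinearMap.id ℂ F).restrictScalars ℝ).contMDiff (n := ∞)).contMDiffAt
    |>.comp x₀ h1
  refine h2.congr_of_eventuallyEq ?_
  filter_upwards [t.open_baseSet.mem_nhds (mem_baseSet_trivializationAt' x₀)] with x hx
  exact (t.linear ℂ hx).map_smul c (s x)

theorem IsSmoothEnd.apply {Φ : Π x, E x →L[ℂ] E x} (hΦ : IsSmoothEnd I F Φ) {s : Π x, E x}
    (hs : IsSmoothSection I F s) : IsSmoothSection I F (fun x ↦ Φ x (s x)) :=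
  ContMDiff.clm_bundle_apply hΦ hs

theorem isSmoothEnd_of_forall_section {Φ : Π x, E x →L[ℂ] E x}
    (h : ∀ s : Π x, E x, IsSmoothSection I F s → IsSmoothSection I F (fun x ↦ Φ x (s x))) :
    IsSmoothEnd I F Φ :=
  haveI : FiniteDimensional ℝ F := FiniteDimensional.complexToReal F
  contMDiff_end_of_forall_section (Φ := fun x ↦ (Φ x).restrictScalars ℝ) h

theorem IsSmoothEnd.sub {Φ Ψ : Π x, E x →L[ℂ] E x} (hΦ : IsSmoothEnd I F Φ)
    (hΨ : IsSmoothEnd I F Ψ) : IsSmoothEnd I F (fun x ↦ Φ x - Ψ x) :=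
  isSmoothEnd_of_forall_section fun _ hs ↦ (hΦ.apply hs).sub (hΨ.apply hs)

theorem IsSmoothEnd.const_smul {Φ : Π x, E x →L[ℂ] E x} (hΦ : IsSmoothEnd I F Φ) (c : ℂ) :
    IsSmoothEnd I F (fun x ↦ c • Φ x) :=
  isSmoothEnd_of_forall_section fun _ hs ↦ (hΦ.apply hs).const_smul c

theorem IsSmoothEnd.lie {Φ Ψ : Π x, E x →L[ℂ] E x} (hΦ : IsSmoothEnd I F Φ)
    (hΨ : IsSmoothEnd I F Ψ) : IsSmoothEnd I F (fun x ↦ ⁅Φ x, Ψ x⁆) :=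
  isSmoothEnd_of_forall_section fun _ hs ↦
    (hΦ.apply (hΨ.apply hs)).sub (hΨ.apply (hΦ.apply hs))

variable (I F) in
/-- Endomorphisms of a fibre that agree on the values of all smooth sections are equal. -/
theorem end_ext_of_smooth_section {x : N} {A B : E x →L[ℂ] E x}
    (h : ∀ s : Π x, E x, IsSmoothSection I F s → A (s x) = B (s x)) : A = B := by
  ext e
  obtain ⟨s, hs, rfl⟩ := exists_contMDiff_section_eq I F e
  exact h s hs

variable (cov : ComplexConnection I F E)

theorem ComplexConnection.map_add {s t : Π x, E x} (hs : IsSmoothSection I F s)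
    (ht : IsSmoothSection I F t) (x : N) (v : TangentSpace I x) :
    cov.toFun (fun y ↦ s y + t y) x v = cov.toFun s x v + cov.toFun t x v :=
  DFunLike.congr_fun
    (cov.isCovariantDerivativeOnUniv.add (hs.mdifferentiableAt x) (ht.mdifferentiableAt x)) v

/-- The axioms give only real constants and the factor i; splitting c into real and imaginary parts
combines them. -/
theorem ComplexConnection.map_const_smul {s : Π x, E x} (hs : IsSmoothSection I F s) (c : ℂ) (x : N)
    (v : TangentSpace I x) : cov.toFun (fun y ↦ c • s y) x v = c • cov.toFun s x v := by
  have hre : ∀ (r : ℝ) {t : Π x, E x}, IsSmoothSection I F t →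
      cov.toFun (fun y ↦ (r : ℂ) • t y) x v = (r : ℂ) • cov.toFun t x v := fun r t ht ↦
    DFunLike.congr_fun
      (cov.isCovariantDerivativeOnUniv.smul_const (σ := t) r (ht.mdifferentiableAt x)) v
  have e : (fun y ↦ c • s y) = fun y ↦ (c.re : ℂ) • s y + (c.im : ℂ) • (Complex.I • s y) := by
    funext y
    conv_lhs => rw [← Complex.re_add_im c, add_smul, mul_smul]
  rw [e, cov.map_add (hs.const_smul _) ((hs.const_smul _).const_smul _), hre _ hs,
    hre _ (hs.const_smul _), cov.map_I_smul _ _ _ (hs.mdifferentiableAt x)]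
  conv_rhs => rw [← Complex.re_add_im c, add_smul, mul_smul]

theorem ComplexConnection.map_sub {s t : Π x, E x} (hs : IsSmoothSection I F s)
    (ht : IsSmoothSection I F t) (x : N) (v : TangentSpace I x) :
    cov.toFun (fun y ↦ s y - t y) x v = cov.toFun s x v - cov.toFun t x v := by
  have h := cov.map_add hs (ht.const_smul (-1)) x v
  rw [cov.map_const_smul ht] at h
  simpa [sub_eq_add_neg] using h

theorem isSmoothSection_covariantDerivative
    (hcov : cov.toCovariantDerivative.ContMDiffCovariantDerivative ∞) {s : Π x, E x}
    (hs : IsSmoothSection I F s) {X : Π x : N, TangentSpace I x}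
    (hX : IsSmoothSection I E₀ X) :
    IsSmoothSection I F (fun x ↦ cov.toFun s x (X x)) := by
  have h := hcov.contMDiff.contMDiff (σ := s) (contMDiffOn_univ.mpr hs)
  exact (contMDiffOn_univ.mp h).clm_bundle_apply hX

theorem endDeriv_apply_section {Φ : Π x, E x →L[ℂ] E x} (hΦ : IsSmoothEnd I F Φ)
    {s : Π x, E x} (hs : IsSmoothSection I F s) (x : N) (v : TangentSpace I x) :
    endDeriv cov Φ x v (s x) = cov.toFun (fun y ↦ Φ y (s y)) x v - Φ x (cov.toFun s x v) :=
  endDeriv_apply cov (hΦ.mdifferentiableAt x) (hs.mdifferentiableAt x) v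

theorem IsSmoothEnd.endDeriv {cov : ComplexConnection I F E}
    (hcov : cov.toCovariantDerivative.ContMDiffCovariantDerivative ∞)
    {Φ : Π x, E x →L[ℂ] E x} (hΦ : IsSmoothEnd I F Φ) {X : Π x : N, TangentSpace I x}
    (hX : IsSmoothSection I E₀ X) : IsSmoothEnd I F (fun x ↦ endDeriv cov Φ x (X x)) := by
  refine isSmoothEnd_of_forall_section fun s hs ↦ ?_
  simp only [endDeriv_apply_section cov hΦ hs]
  exact (isSmoothSection_covariantDerivative cov hcov (hΦ.apply hs) hX).sub
    (hΦ.apply (isSmoothSection_covariantDerivative cov hcov hs hX))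

theorem endDeriv_sub {Φ Ψ : Π x, E x →L[ℂ] E x} (hΦ : IsSmoothEnd I F Φ)
    (hΨ : IsSmoothEnd I F Ψ) (x : N) (v : TangentSpace I x) :
    endDeriv cov (fun y ↦ Φ y - Ψ y) x v = endDeriv cov Φ x v - endDeriv cov Ψ x v := by
  refine end_ext_of_smooth_section I F fun s hs ↦ ?_
  rw [sub_apply, endDeriv_apply_section cov (hΦ.sub hΨ) hs, endDeriv_apply_section cov hΦ hs,
    endDeriv_apply_section cov hΨ hs]
  simp only [sub_apply]
  rw [cov.map_sub (hΦ.apply hs) (hΨ.apply hs)]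
  abel

theorem endDeriv_const_smul {Φ : Π x, E x →L[ℂ] E x} (hΦ : IsSmoothEnd I F Φ) (c : ℂ) (x : N)
    (v : TangentSpace I x) :
    endDeriv cov (fun y ↦ c • Φ y) x v = c • endDeriv cov Φ x v := by
  refine end_ext_of_smooth_section I F fun s hs ↦ ?_
  rw [smul_apply, endDeriv_apply_section cov (hΦ.const_smul c) hs,
    endDeriv_apply_section cov hΦ hs]
  simp only [smul_apply]
  rw [cov.map_const_smul (hΦ.apply hs), smul_sub]

theorem endDeriv_lie {Φ Ψ : Π x, E x →L[ℂ] E x} (hΦ : IsSmoothEnd I F Φ)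
    (hΨ : IsSmoothEnd I F Ψ) (x : N) (v : TangentSpace I x) :
    endDeriv cov (fun y ↦ ⁅Φ y, Ψ y⁆) x v
      = ⁅endDeriv cov Φ x v, Ψ x⁆ + ⁅Φ x, endDeriv cov Ψ x v⁆ := by
  refine end_ext_of_smooth_section I F fun s hs ↦ ?_
  have h1 := endDeriv_apply_section cov hΦ (hΨ.apply hs) x v
  have h2 := endDeriv_apply_section cov hΨ (hΦ.apply hs) x v
  have h3 := endDeriv_apply_section cov hΦ hs x v
  have h4 := endDeriv_apply_section cov hΨ hs x v
  rw [endDeriv_apply_section cov (hΦ.lie hΨ) hs]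
  simp only [Ring.lie_def, sub_apply, add_apply, mul_apply_eq_comp, h1, h2, h3, h4,
    _root_.map_sub]
  rw [cov.map_sub (hΦ.apply (hΨ.apply hs)) (hΨ.apply (hΦ.apply hs))]
  abel

/-- The added terms are θ(v) a(Φs) and -Φ(θ(v) a s), whose sum is a commutator. No derivative of a
occurs. -/
theorem endDeriv_addEndForm {a Φ : Π x, E x →L[ℂ] E x} (hΦ : IsSmoothEnd I F Φ)
    (θ : Π x : N, TangentSpace I x →L[ℝ] ℝ) (x : N) (v : TangentSpace I x) :
    endDeriv (addEndForm cov a θ) Φ x v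
      = endDeriv cov Φ x v + (θ x v : ℂ) • ⁅a x, Φ x⁆ := by
  refine end_ext_of_smooth_section I F fun s hs ↦ ?_
  have hr : ∀ (r : ℝ) (w : E x), r • w = (r : ℂ) • w := fun r w ↦ rfl
  rw [endDeriv_apply_section _ hΦ hs, add_apply, endDeriv_apply_section cov hΦ hs]
  simp only [addEndForm, add_apply, ContinuousLinearMap.smulRight_apply, smul_apply, Ring.lie_def,
    sub_apply, mul_apply_eq_comp, _root_.map_add, hr, map_smul, smul_sub]
  abel

/-- The commutator of covariant derivatives on endomorphism fields is the commutator with the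
curvature. -/
theorem endDeriv_commutator_apply
    (hcov : cov.toCovariantDerivative.ContMDiffCovariantDerivative ∞)
    {Φ : Π x, E x →L[ℂ] E x} (hΦ : IsSmoothEnd I F Φ) {X Y : Π x : N, TangentSpace I x}
    (hX : IsSmoothSection I E₀ X) (hY : IsSmoothSection I E₀ Y)
    {s : Π x, E x} (hs : IsSmoothSection I F s) (x : N) :
    (endDeriv cov (fun y ↦ endDeriv cov Φ y (Y y)) x (X x)
        - endDeriv cov (fun y ↦ endDeriv cov Φ y (X y)) x (Y x)
        - endDeriv cov Φ x (VectorField.mlieBracket I X Y x)) (s x)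
      = curvature I cov X Y (fun y ↦ Φ y (s y)) x - Φ x (curvature I cov X Y s x) := by
  have hd := fun {s : Π x, E x} {X} (hs : IsSmoothSection I F s) (hX : IsSmoothSection I E₀ X) ↦
    isSmoothSection_covariantDerivative cov hcov hs hX
  rw [sub_apply, sub_apply, endDeriv_apply_section cov (hΦ.endDeriv hcov hY) hs,
    endDeriv_apply_section cov (hΦ.endDeriv hcov hX) hs, endDeriv_apply_section cov hΦ hs]
  -- The mixed terms (∇_Y Φ)(∇_X s) and (∇_X Φ)(∇_Y s) are expanded by the product rule as well;
  -- everything outside the two curvatures then cancels.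
  have h1 := endDeriv_apply_section cov hΦ (hd hs hX) x (Y x)
  have h2 := endDeriv_apply_section cov hΦ (hd hs hY) x (X x)
  simp only [h1, h2]
  simp only [endDeriv_apply_section cov hΦ hs]
  rw [cov.map_sub (hd (hΦ.apply hs) hY) (hΦ.apply (hd hs hY)),
    cov.map_sub (hd (hΦ.apply hs) hX) (hΦ.apply (hd hs hX))]
  simp only [curvature, _root_.map_sub]
  abel

theorem endDerivC_add_I (Φ : Π x, E x →L[ℂ] E x) (x : N) (v w : TangentSpace I x) :
    endDerivC cov Φ x ((1 : ℂ) ⊗ₜ[ℝ] v + Complex.I ⊗ₜ[ℝ] w)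
      = endDeriv cov Φ x v + Complex.I • endDeriv cov Φ x w := by
  simp [endDerivC]

theorem endDerivC_sub_I (Φ : Π x, E x →L[ℂ] E x) (x : N) (v w : TangentSpace I x) :
    endDerivC cov Φ x ((1 : ℂ) ⊗ₜ[ℝ] v - Complex.I ⊗ₜ[ℝ] w)
      = endDeriv cov Φ x v - Complex.I • endDeriv cov Φ x w := by
  simp [endDerivC]

end EndomorphismFields

/-- Orthogonality to u and v makes w a multiple of u × v, with coefficient vol(u, v, w). Inverting
this expresses u × v through w, the metric and the volume form, all of which can be chosen smooth.
-/
theorem crossProd_eq_smul_of_orthogonal {V : Type*} [NormedAddCommGroup V] [InnerProductSpace ℝ V]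
    [Fact (Module.finrank ℝ V = 3)] (o : Orientation ℝ V (Fin 3)) {u v w : V} (hu : ‖u‖ = 1)
    (hv : ‖v‖ = 1) (huv : inner ℝ u v = 0) (hwu : inner ℝ w u = 0) (hwv : inner ℝ w v = 0)
    (hw : inner ℝ w w ≠ 0) :
    crossProd o u v = (o.volumeForm ![u, v, w] / inner ℝ w w) • w := by
  have hcu := inner_crossProd_left o u v
  have hcv := inner_crossProd_right o u v
  have hcc : inner ℝ (crossProd o u v) (crossProd o u v) = 1 := by
    rw [real_inner_self_eq_norm_sq, norm_crossProd_of_orthonormal o hu hv huv, one_pow]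
  rw [← inner_crossProd, real_inner_comm]
  have e : w = inner ℝ w (crossProd o u v) • crossProd o u v := by
    refine ext_inner_frame o hu hv huv ?_ ?_ ?_
    · rw [inner_smul_left, hcu, hwu, mul_zero]
    · rw [inner_smul_left, hcv, hwv, mul_zero]
    · rw [inner_smul_left, hcc, mul_one]; rfl
  have e2 : inner ℝ w w = inner ℝ w (crossProd o u v) ^ 2 := by
    nth_rewrite 2 [e]
    rw [inner_smul_right, sq]
  rw [e2] at hw ⊢
  nth_rewrite 3 [e]
  rw [smul_smul, div_mul_eq_mul_div, ← sq, div_self hw, one_smul]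

/-! ### Unit Killing fields and the rotation j -/

section ThreeManifolds

variable {N : Type*} [TopologicalSpace N] [T2Space N]
  [ChartedSpace (EuclideanSpace ℝ (Fin 3)) N] [IsManifold (𝓡 3) ∞ N]
  [RiemannianBundle (fun x : N ↦ TangentSpace (𝓡 3) x)]
  {o : Π x : N, Orientation ℝ (TangentSpace (𝓡 3) x) (Fin 3)}
  {ξ σ : Π x : N, TangentSpace (𝓡 3) x}

/-- The rotation `j` maps smooth unit fields in `ξ^⊥` to smooth fields. -/
theorem isSmoothVF_rot
    [IsContMDiffRiemannianBundle (𝓡 3) ∞ (EuclideanSpace ℝ (Fin 3))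
      (fun x : N ↦ TangentSpace (𝓡 3) x)]
    (ho : IsSmoothOrientation o) (hξ : IsSmoothVF ξ) (hξ_unit : ∀ x, ‖ξ x‖ = 1)
    (hσ : IsSmoothVF σ) (hσ_unit : ∀ x, ‖σ x‖ = 1) (hσ_perp : ∀ x, inner ℝ (ξ x) (σ x) = 0) :
    IsSmoothVF (rot o ξ σ) := by
  intro x₀
  obtain ⟨W, hW, hW₀⟩ := exists_contMDiff_section_eq (𝓡 3) (EuclideanSpace ℝ (Fin 3))
    (rot o ξ σ x₀)
  have hinner : ∀ {X Y : Π x : N, TangentSpace (𝓡 3) x}, IsSmoothVF X → IsSmoothVF Y →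
      ContMDiff (𝓡 3) 𝓘(ℝ, ℝ) ∞ (fun x ↦ inner ℝ (X x) (Y x)) := fun hX hY ↦
    ContMDiff.inner_bundle (F := EuclideanSpace ℝ (Fin 3))
      (E := fun x : N ↦ TangentSpace (𝓡 3) x) (b := id) hX hY
  -- Gram–Schmidt applied to a smooth extension W of jσ(x₀): τ is smooth, orthogonal to ξ and σ
  -- everywhere, and equals jσ at x₀, hence is nonzero nearby.
  let τ : Π x : N, TangentSpace (𝓡 3) x := fun x ↦
    W x - inner ℝ (W x) (ξ x) • ξ x - inner ℝ (W x) (σ x) • σ x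
  have hτ : IsSmoothVF τ := ContMDiff.sub_section
    (ContMDiff.sub_section hW (ContMDiff.smul_section (hinner hW hξ) hξ))
    (ContMDiff.smul_section (hinner hW hσ) hσ)
  have hu : ∀ x, inner ℝ (ξ x) (ξ x) = 1 := fun x ↦ by
    rw [real_inner_self_eq_norm_sq, hξ_unit, one_pow]
  have hs : ∀ x, inner ℝ (σ x) (σ x) = 1 := fun x ↦ by
    rw [real_inner_self_eq_norm_sq, hσ_unit, one_pow]
  have hτξ : ∀ x, inner ℝ (τ x) (ξ x) = 0 := fun x ↦ by
    simp only [τ, inner_sub_left, real_inner_smul_left, hu, real_inner_comm (ξ x) (σ x), hσ_perp]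
    ring
  have hτσ : ∀ x, inner ℝ (τ x) (σ x) = 0 := fun x ↦ by
    simp only [τ, inner_sub_left, real_inner_smul_left, hs, hσ_perp]
    ring
  have hτ₀ : inner ℝ (τ x₀) (τ x₀) ≠ 0 := by
    have : τ x₀ = rot o ξ σ x₀ := by
      simp only [τ, hW₀, rot, inner_crossProd_left, inner_crossProd_right, zero_smul,
        sub_zero]
    rw [this, real_inner_self_eq_norm_sq, rot,
      norm_crossProd_of_orthonormal _ (hξ_unit x₀) (hσ_unit x₀) (hσ_perp x₀)]
    norm_num
  have hττ := (hinner hτ hτ).contMDiffAt (x := x₀)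
  have hf : ContMDiffAt (𝓡 3) 𝓘(ℝ, ℝ) ∞
      (fun x ↦ (o x).volumeForm ![ξ x, σ x, τ x] / inner ℝ (τ x) (τ x)) x₀ :=
    (ho ξ σ τ hξ hσ hτ x₀).div₀ hττ hτ₀
  refine (hf.smul_section (hτ x₀)).congr_of_eventuallyEq ?_
  filter_upwards [hττ.continuousAt.eventually_ne hτ₀] with x hx
  rw [rot, crossProd_eq_smul_of_orthogonal (o x) (hξ_unit x) (hσ_unit x) (hσ_perp x)
    (hτξ x) (hτσ x) hx]
  rfl

/-- The Killing identity when the inner product is constant, so that its derivative along ξ drops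
out. -/
theorem IsKilling.inner_mlieBracket_add (hξ : IsKilling ξ) {X Y : Π x : N, TangentSpace (𝓡 3) x}
    (hX : IsSmoothVF X) (hY : IsSmoothVF Y) {c : ℝ} (h : ∀ x, inner ℝ (X x) (Y x) = c) (x : N) :
    inner ℝ (VectorField.mlieBracket (𝓡 3) ξ X x) (Y x)
      + inner ℝ (X x) (VectorField.mlieBracket (𝓡 3) ξ Y x) = 0 := by
  rw [← hξ X Y hX hY x, funext h]
  simp [mvfderiv]

/-- The bracket of a unit Killing field `ξ` with a unit field orthogonal to `ξ`. -/
theorem mlieBracket_killing (hξ : IsSmoothVF ξ) (hξ_unit : ∀ x, ‖ξ x‖ = 1)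
    (hξ_killing : IsKilling ξ) (hσ : IsSmoothVF σ) (hσ_unit : ∀ x, ‖σ x‖ = 1)
    (hσ_perp : ∀ x, inner ℝ (ξ x) (σ x) = 0) (x : N) :
    VectorField.mlieBracket (𝓡 3) ξ σ x
      = (inner ℝ (VectorField.mlieBracket (𝓡 3) ξ σ x) (rot o ξ σ x) : ℝ) • rot o ξ σ x := by
  have hcc : inner ℝ (rot o ξ σ x) (rot o ξ σ x) = (1 : ℝ) := by
    rw [real_inner_self_eq_norm_sq, rot, norm_crossProd_of_orthonormal _ (hξ_unit x) (hσ_unit x)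
      (hσ_perp x), one_pow]
  -- The pair (ξ, σ), with [ξ, ξ] = 0, gives [ξ, σ] ⟂ ξ; the pair (σ, σ) gives [ξ, σ] ⟂ σ. Only the
  -- jσ component survives.
  have h1 := hξ_killing.inner_mlieBracket_add hξ hσ hσ_perp x
  have h2 := hξ_killing.inner_mlieBracket_add hσ hσ (c := 1)
    (fun x ↦ by rw [real_inner_self_eq_norm_sq, hσ_unit, one_pow]) x
  rw [VectorField.mlieBracket_self, Pi.zero_apply, inner_zero_left, zero_add, real_inner_comm] at h1
  rw [real_inner_comm (VectorField.mlieBracket (𝓡 3) ξ σ x) (σ x)] at h2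
  refine ext_inner_frame (o x) (hξ_unit x) (hσ_unit x) (hσ_perp x) ?_ ?_ ?_
  · rw [h1, real_inner_smul_left, rot, inner_crossProd_left, mul_zero]
  · rw [real_inner_smul_left, rot, inner_crossProd_right, mul_zero]
    linarith
  · change _ = inner ℝ _ (rot o ξ σ x)
    rw [real_inner_smul_left, hcc, mul_one]
    rfl

/-! ### Commuting covariant derivatives by the monopole equation -/

variable {F : Type*} [NormedAddCommGroup F] [NormedSpace ℂ F] [FiniteDimensional ℂ F]
  {E : N → Type*} [TopologicalSpace (TotalSpace F E)]
  [∀ x, AddCommGroup (E x)] [∀ x, Module ℂ (E x)] [∀ x, TopologicalSpace (E x)]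
  [∀ x, IsTopologicalAddGroup (E x)] [∀ x, ContinuousSMul ℂ (E x)]
  [∀ x, ContinuousSMul ℝ (E x)]
  [FiberBundle F E] [VectorBundle ℂ F E] [VectorBundle ℝ F E]
  [ContMDiffVectorBundle ∞ F E (𝓡 3)]
  {cov : ComplexConnection (𝓡 3) F E} {φ Φ : Π x, E x →L[ℂ] E x}

theorem IsMonopole.endDeriv_commutator (hmonopole : IsMonopole o cov φ)
    (hcov : cov.toCovariantDerivative.ContMDiffCovariantDerivative ∞)
    (hΦ : IsSmoothEnd (𝓡 3) F Φ) {X Y : Π x : N, TangentSpace (𝓡 3) x}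
    (hX : IsSmoothVF X) (hY : IsSmoothVF Y) (x : N) :
    endDeriv cov (fun y ↦ endDeriv cov Φ y (Y y)) x (X x)
        - endDeriv cov (fun y ↦ endDeriv cov Φ y (X y)) x (Y x)
        - endDeriv cov Φ x (VectorField.mlieBracket (𝓡 3) X Y x)
      = (2 : ℂ) • ⁅endDeriv cov φ x (crossProd (o x) (X x) (Y x)), Φ x⁆ := by
  refine end_ext_of_smooth_section (𝓡 3) F fun s hs ↦ ?_
  rw [endDeriv_commutator_apply cov hcov hΦ hX hY hs, hmonopole X Y s hX hY hs x,
    hmonopole X Y _ hX hY (hΦ.apply hs) x]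
  simp [hodgeStar, Ring.lie_def, smul_sub]

/-- `∇_ξ ∇_Z Φ` for a unit Killing field `ξ`, in terms of `∇_Z ∇_ξ Φ`. -/
theorem IsMonopole.endDeriv_endDerivC_fieldZ
    (hmonopole : IsMonopole o cov φ)
    (hcov : cov.toCovariantDerivative.ContMDiffCovariantDerivative ∞)
    (hΦ : IsSmoothEnd (𝓡 3) F Φ)
    (hξ : IsSmoothVF ξ) (hξ_unit : ∀ x, ‖ξ x‖ = 1) (hξ_killing : IsKilling ξ)
    (hσ : IsSmoothVF σ) (hσ_unit : ∀ x, ‖σ x‖ = 1) (hσ_perp : ∀ x, inner ℝ (ξ x) (σ x) = 0)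
    (hj : IsSmoothVF (rot o ξ σ)) (x : N) :
    endDeriv cov (fun y ↦ endDerivC cov Φ y (fieldZ o ξ σ y)) x (ξ x)
      = endDerivC cov (fun y ↦ endDeriv cov Φ y (ξ y)) x (fieldZ o ξ σ x)
        + (2 * Complex.I) • ⁅endDerivC cov φ x (fieldZ o ξ σ x), Φ x⁆
        - (4 * Complex.I * (lam o ξ σ x : ℂ)) • endDerivC cov Φ x (fieldZ o ξ σ x) := by
  set k : ℝ := inner ℝ (VectorField.mlieBracket (𝓡 3) ξ σ x) (rot o ξ σ x) with hk
  have hjj : ∀ x, rot o ξ (rot o ξ σ) x = -σ x := fun x ↦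
    crossProd_crossProd_self (o x) (hξ_unit x) (hσ_unit x) (hσ_perp x)
  have hlam : lam o ξ σ x = -(1 / 4) * k := by
    rw [lam, VectorField.mlieBracket_swap_apply, inner_neg_left, hk]
    ring
  have hb1 := mlieBracket_killing (o := o) hξ hξ_unit hξ_killing hσ hσ_unit hσ_perp x
  -- The same bracket formula for the unit field jσ, with j(jσ) = -σ. The Killing identity for (σ,
  -- jσ) then identifies its coefficient, giving [ξ, jσ] = -k σ.
  have hb2 := mlieBracket_killing (o := o) hξ hξ_unit hξ_killing hj
    (fun x ↦ norm_crossProd_of_orthonormal (o x) (hξ_unit x) (hσ_unit x) (hσ_perp x))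
    (fun x ↦ by rw [real_inner_comm]; exact inner_crossProd_left _ _ _) x
  have hkill := hξ_killing.inner_mlieBracket_add hσ hj (c := 0)
    (fun x ↦ by rw [real_inner_comm]; exact inner_crossProd_right _ _ _) x
  rw [real_inner_comm (VectorField.mlieBracket (𝓡 3) ξ (rot o ξ σ) x)] at hkill
  rw [hjj, inner_neg_right, smul_neg, neg_smul, neg_neg, eq_neg_of_add_eq_zero_right hkill] at hb2
  rw [← hk] at hb1 hb2
  have h1 := hmonopole.endDeriv_commutator hcov hΦ hξ hσ x
  have h2 := hmonopole.endDeriv_commutator hcov hΦ hξ hj x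
  -- With ξ × σ = jσ this is ξ × Z = iZ, the source of the factor 2i in the curvature term.
  have hjx : crossProd (o x) (ξ x) (rot o ξ σ x) = -σ x := hjj x
  have hjx' : crossProd (o x) (ξ x) (σ x) = rot o ξ σ x := rfl
  rw [hb1, hjx'] at h1
  rw [hb2, hjx] at h2
  have hS := hΦ.endDeriv hcov hσ
  have hJ := hΦ.endDeriv hcov hj
  have hr : ∀ (r : ℝ) (A : E x →L[ℂ] E x), r • A = (r : ℂ) • A := fun r A ↦ rfl
  simp only [fieldZ, endDerivC_sub_I]
  rw [endDeriv_sub cov hS (hJ.const_smul _), endDeriv_const_smul cov hJ, hlam]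
  simp only [map_smul, map_neg, hr, Ring.lie_def, sub_mul, mul_sub, neg_mul, mul_neg, smul_mul_assoc,
    mul_smul_comm] at h1 h2 ⊢
  rw [sub_eq_iff_eq_add, sub_eq_iff_eq_add] at h1 h2
  rw [h1, h2]
  push_cast
  match_scalars <;> first | ring1 | (ring_nf; simp only [Complex.I_sq]; ring1)

/-- On complex vectors orthogonal to `ξ` the connections `∇̂` and `∇` agree. -/
theorem endDerivC_hatConn_add {Ψ : Π x, E x →L[ℂ] E x} (hΨ : IsSmoothEnd (𝓡 3) F Ψ) (x : N)
    {v w : TangentSpace (𝓡 3) x} (hv : inner ℝ (ξ x) v = 0) (hw : inner ℝ (ξ x) w = 0) (z : ℂ) :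
    endDerivC (hatConn cov φ ξ) Ψ x ((1 : ℂ) ⊗ₜ[ℝ] v + z ⊗ₜ[ℝ] w)
      = endDerivC cov Ψ x ((1 : ℂ) ⊗ₜ[ℝ] v + z ⊗ₜ[ℝ] w) := by
  simp [endDerivC, hatConn, endDeriv_addEndForm cov hΨ, hv, hw]

end ThreeManifolds

/-! ### The coupled system -/

theorem proposition3
    {N : Type*} [TopologicalSpace N] [T2Space N] [SecondCountableTopology N]
    [ChartedSpace (EuclideanSpace ℝ (Fin 3)) N] [IsManifold (𝓡 3) ∞ N]
    [RiemannianBundle (fun x : N ↦ TangentSpace (𝓡 3) x)]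
    [IsContMDiffRiemannianBundle (𝓡 3) ∞ (EuclideanSpace ℝ (Fin 3))
      (fun x : N ↦ TangentSpace (𝓡 3) x)]
    (o : Π x : N, Orientation ℝ (TangentSpace (𝓡 3) x) (Fin 3)) (ho : IsSmoothOrientation o)
    (ξ : Π x : N, TangentSpace (𝓡 3) x) (hξ : IsSmoothVF ξ) (hξ_unit : ∀ x, ‖ξ x‖ = 1)
    (hξ_killing : IsKilling ξ)
    (σ : Π x : N, TangentSpace (𝓡 3) x) (hσ : IsSmoothVF σ) (hσ_unit : ∀ x, ‖σ x‖ = 1)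
    (hσ_perp : ∀ x, inner ℝ (σ x) (ξ x) = 0)
    {F : Type*} [NormedAddCommGroup F] [NormedSpace ℂ F] [FiniteDimensional ℂ F]
    {E : N → Type*} [TopologicalSpace (TotalSpace F E)]
    [∀ x, AddCommGroup (E x)] [∀ x, Module ℂ (E x)] [∀ x, TopologicalSpace (E x)]
    [∀ x, IsTopologicalAddGroup (E x)] [∀ x, ContinuousSMul ℂ (E x)]
    [∀ x, ContinuousSMul ℝ (E x)]
    [FiberBundle F E] [VectorBundle ℂ F E] [VectorBundle ℝ F E]
    [ContMDiffVectorBundle ∞ F E (𝓡 3)]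
    (cov : ComplexConnection (𝓡 3) F E)
    (hcov : cov.toCovariantDerivative.ContMDiffCovariantDerivative ∞)
    (φ : Π x, E x →L[ℂ] E x) (hφ : IsSmoothEnd (𝓡 3) F φ)
    (hmonopole : IsMonopole o cov φ)
    (Φ : Π x, E x →L[ℂ] E x) (hΦ : IsSmoothEnd (𝓡 3) F Φ)
    (hpotential : ∀ x, endDeriv (hatConn cov φ ξ) Φ x (ξ x) = φ x)
    (h₁ : ∀ x, endDerivC cov (fun y ↦ endDerivC cov Φ y (fieldZ o ξ σ y)) x (fieldZbar o ξ σ x)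
      + endDeriv cov φ x (ξ x) = 0)
    (h₂ : ∀ x, (lam o ξ σ x : ℂ) • endDerivC cov Φ x (fieldZ o ξ σ x)
      - ⁅endDerivC cov φ x (fieldZ o ξ σ x), Φ x⁆ = 0)
    (ψ : Π x, E x →L[ℂ] E x)
    (hψ : ψ = fun x ↦ (-2 * Complex.I) • endDerivC (hatConn cov φ ξ) Φ x (fieldZ o ξ σ x)) :
    IsSmoothEnd (𝓡 3) F ψ ∧
    (∀ x, endDerivC (hatConn cov φ ξ) ψ x (fieldZbar o ξ σ x)
      = - endDeriv (hatConn cov φ ξ) (twist φ) x (ξ x)) ∧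
    (∀ x, endDeriv (hatConn cov φ ξ) ψ x (ξ x)
      = endDerivC (hatConn cov φ ξ) (twist φ) x (fieldZ o ξ σ x)) := by
  have hξσ : ∀ x, inner ℝ (ξ x) (σ x) = 0 := fun x ↦ by rw [real_inner_comm, hσ_perp]
  have hj : IsSmoothVF (rot o ξ σ) := isSmoothVF_rot ho hξ hξ_unit hσ hσ_unit hξσ
  have hξj : ∀ x, inner ℝ (ξ x) (rot o ξ σ x) = 0 := fun x ↦ by
    rw [real_inner_comm]
    exact inner_crossProd_left _ _ _
  have hZbar : ∀ {Ψ : Π x, E x →L[ℂ] E x}, IsSmoothEnd (𝓡 3) F Ψ → ∀ x,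
      endDerivC (hatConn cov φ ξ) Ψ x (fieldZbar o ξ σ x)
        = endDerivC cov Ψ x (fieldZbar o ξ σ x) := fun hΨ x ↦
    endDerivC_hatConn_add hΨ x (hξσ x) (hξj x) Complex.I
  have hZ : ∀ {Ψ : Π x, E x →L[ℂ] E x}, IsSmoothEnd (𝓡 3) F Ψ → ∀ x,
      endDerivC (hatConn cov φ ξ) Ψ x (fieldZ o ξ σ x)
        = endDerivC cov Ψ x (fieldZ o ξ σ x) := fun hΨ x ↦ by
    have h := endDerivC_hatConn_add (cov := cov) (φ := φ) hΨ x (hξσ x) (hξj x) (-Complex.I)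
    rwa [TensorProduct.neg_tmul, ← sub_eq_add_neg] at h
  have hhat : ∀ {Ψ : Π x, E x →L[ℂ] E x}, IsSmoothEnd (𝓡 3) F Ψ → ∀ x,
      endDeriv (hatConn cov φ ξ) Ψ x (ξ x) = endDeriv cov Ψ x (ξ x) + ⁅twist φ x, Ψ x⁆ := by
    intro Ψ hΨ x
    simp [hatConn, endDeriv_addEndForm cov hΨ, hξ_unit]
  have htwist : IsSmoothEnd (𝓡 3) F (twist φ) := hφ.const_smul _
  have hP : IsSmoothEnd (𝓡 3) F (fun x ↦ endDerivC cov Φ x (fieldZ o ξ σ x)) := by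
    simp only [fieldZ, endDerivC_sub_I]
    exact (hΦ.endDeriv hcov hσ).sub ((hΦ.endDeriv hcov hj).const_smul _)
  have hψ' : ψ = fun x ↦ (-2 * Complex.I) • endDerivC cov Φ x (fieldZ o ξ σ x) := by
    rw [hψ]
    funext x
    rw [hZ hΦ]
  have hψs : IsSmoothEnd (𝓡 3) F ψ := hψ' ▸ hP.const_smul _
  have hdtwist : ∀ x v, endDeriv cov (twist φ) x v = (-2 * Complex.I) • endDeriv cov φ x v :=
    endDeriv_const_smul cov hφ _
  refine ⟨hψs, fun x ↦ ?_, fun x ↦ ?_⟩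
  · rw [hZbar hψs, hhat htwist, Ring.lie_def, sub_self, add_zero, hdtwist, ← smul_neg,
      ← eq_neg_of_add_eq_zero_left (h₁ x), hψ', fieldZbar, endDerivC_add_I, endDerivC_add_I,
      endDeriv_const_smul cov hP, endDeriv_const_smul cov hP, smul_add, smul_comm Complex.I]
  -- The potential equation solved for ∇_ξ Φ, so that it can be differentiated along Z.
  · have hG : (fun y ↦ endDeriv cov Φ y (ξ y)) = fun y ↦ φ y - ⁅twist φ y, Φ y⁆ := by
      funext y
      rw [← hpotential y, hhat hΦ, add_sub_cancel_right]
    have key := hmonopole.endDeriv_endDerivC_fieldZ hcov hΦ hξ hξ_unit hξ_killing hσ hσ_unit hξσ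
      hj x
    have hdG : ∀ v, endDeriv cov (fun y ↦ φ y - ⁅twist φ y, Φ y⁆) x v
        = endDeriv cov φ x v - (⁅(-2 * Complex.I) • endDeriv cov φ x v, Φ x⁆
          + ⁅twist φ x, endDeriv cov Φ x v⁆) := fun v ↦ by
      rw [endDeriv_sub cov hφ (htwist.lie hΦ), endDeriv_lie cov htwist hΦ, hdtwist]
    rw [hhat hψs, hZ htwist]
    simp only [hψ']
    rw [endDeriv_const_smul cov hP, key, hG]
    have h2 := h₂ x
    simp only [fieldZ, endDerivC_sub_I, hdG, hdtwist] at h2 ⊢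
    simp only [Ring.lie_def, sub_mul, mul_sub, smul_mul_assoc, mul_smul_comm] at h2 ⊢
    -- The coefficient is (-2i)(-4i) = -8: the factor in ψ times the factor of the second hypothesis
    -- in ∇̂_ξ∇_Z Φ.
    linear_combination (norm := skip) (-8 : ℂ) • h2
    match_scalars <;> first | ring1 | (ring_nf; simp only [Complex.I_sq, Complex.I_pow_three]; ring1)
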